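/- **Conventions.** Smooth maps between open subsets of Hausdorff locally convex real topological vector spaces are the continuous maps all of whose iterated directional derivatives $d^jf(x)(h_1,\dots,h_j)$ exist and are jointly continuous in $(x,h_1,\dots,h_j)$. Manifolds are smooth manifolds modelled on such spaces. For a smooth function $F$ on a manifold $M$, $\mathrm dF(m)\colon T_m(M)\to\mathbb R$ denotes its differential at $m$, and for a smooth map $q\colon M\to N$, $T_m(q)\colon T_m(M)\to T_{q(m)}(N)$ denotes its tangent map. A *weak Poisson structure* on a manifold $M$ is a unital subalgebra $\mathcal A\subseteq C^\infty(M,\mathbb R)$ together with an $\mathbb R$-bilinear map $\{\cdot,\cdot\}\colon\mathcal A\times\mathcal A\to\mathcal A$ such that * (P1) $\{F,G\}=-\{G,F\}$, $\{F,\{G,H\}\}=\{\{F,G\},H\}+\{G,\{F,H\}\}$ and $\{F,GH\}=\{F,G\}H+G\{F,H\}$ for all $F,G,H\in\mathcal A$; * (P2) if $m\in M$ and $v\in T_m(M)$ satisfy $\mathrm dF(m)v=0$ for all $F\in\mathcal A$, then $v=0$; * (P3) for every $H\in\mathcal A$ there is a smooth vector field $X_H$ on $M$ with $\mathrm dF(m)X_H(m)=\{F,H\}(m)$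 for all $F\in\mathcal A$ and $m\in M$. A *weak Poisson manifold* is a manifold with a weak Poisson structure. A smooth map $\varphi\colon M\to N$ between weak Poisson manifolds $(M,\mathcal A_M)$ and $(N,\mathcal A_N)$ is a *Poisson map* if $\varphi^*\mathcal A_N\subseteq\mathcal A_M$ and $\varphi^*\{f,g\}=\{\varphi^*f,\varphi^*g\}$ for all $f,g\in\mathcal A_N$, where $\varphi^*f=f\circ\varphi$. A *submersion* is a surjective smooth map $q\colon M\to N$ such that every point of $N$ has an open neighbourhood on which $q$ has a smooth section. **Proposition (Smooth Poisson quotients).** Let $(M,\mathcal A_M,\{\cdot,\cdot\})$ be a weak Poisson manifold, let $N$ be a manifold, and let $q\colon M\to N$ be a submersion. Let $\mathcal B\subseteq q^*C^\infty(N,\mathbb R)\cap\mathcal A_M$ be a Poisson subalgebra, i.e. a unital subalgebra closed under the bracket $\{\cdot,\cdot\}$ of $\mathcal A_M$. Then there is a weak Poisson structure $(\mathcal A_N,\{\cdot,\cdot\}_N)$ on $N$ with $q^*\mathcal A_N=\mathcal B$ for which $q$ is a Poisson map if and only if $$\ker T_m(q)=\{v\in T_m(M) : \mathrm dF(m)v=0\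 \text{ for all } F\in\mathcal B\}\qquad\text{for every } m\in M.$$ -/

import Mathlib

open Set Filter Topology

/-! ### Differential calculus in locally convex spaces (Michal-Bastiani calculus) -/

noncomputable section

/-- `f` has derivative `w` at `x` in the direction `h`:
`w = lim_{t → 0, t ≠ 0} (f (x + t h) - f x) / t`. -/
def HasDirDerivAt {E F : Type*} [AddCommGroup E] [Module ℝ E]
    [AddCommGroup F] [Module ℝ F] [TopologicalSpace F]
    (f : E → F) (w : F) (x h : E) : Prop :=
  Tendsto (fun t : ℝ => t⁻¹ • (f (x + t • h) - f x)) (𝓝[≠] (0 : ℝ)) (𝓝 w)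

/-- The directional derivative `df(x)(h)`. It is only used where the limit exists
(the target spaces are Hausdorff, so the limit is unique). -/
def dirDeriv {E F : Type*} [AddCommGroup E] [Module ℝ E]
    [AddCommGroup F] [Module ℝ F] [TopologicalSpace F]
    (f : E → F) (x h : E) : F :=
  letI : Nonempty F := ⟨0⟩
  limUnder (𝓝[≠] (0 : ℝ)) (fun t : ℝ => t⁻¹ • (f (x + t • h) - f x))

/-- `f` is a `C^k`-map on the open set `U`, in the usual recursive form: `C^0` means continuous, and
`f` is `C^(k+1)` if it is continuous, all directional derivatives `df(x)(h)`, `x ∈ U`, exist, and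
`df : U × E → F`, `(x, h) ↦ df(x)(h)`, is `C^k`.  (For open `U` and Hausdorff locally convex spaces
this says precisely that `f` is continuous and the iterated directional derivatives
`d^j f : U × E^j → F`, `j ≤ k`, exist and are continuous.) -/
def LCContDiffOn {F : Type*} [AddCommGroup F] [Module ℝ F] [TopologicalSpace F] :
    ℕ → ∀ {E : Type*} [AddCommGroup E] [Module ℝ E] [TopologicalSpace E],
      (E → F) → Set E → Prop
  | 0, _, _, _, _, f, U => ContinuousOn f U
  | k + 1, E, _, _, _, f, U => ContinuousOn f U ∧
      ∃ df : E × E → F, (∀ x ∈ U, ∀ h : E, HasDirDerivAt f (df (x, h)) x h) ∧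
        LCContDiffOn k df (U ×ˢ (univ : Set E))

/-- `f` is smooth (`C^∞`) on the open set `U`. -/
def LCSmoothOn {E F : Type*} [AddCommGroup E] [Module ℝ E] [TopologicalSpace E]
    [AddCommGroup F] [Module ℝ F] [TopologicalSpace F] (f : E → F) (U : Set E) : Prop :=
  ∀ k : ℕ, LCContDiffOn k f U

/-! ### Manifolds modelled on locally convex spaces -/

/-- A topological space `M` with an atlas of charts with values in open subsets of `E` is a smooth
manifold modelled on `E` if all chart changes are smooth. -/
class LCManifold (E : Type*) [AddCommGroup E] [Module ℝ E] [TopologicalSpace E]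
    (M : Type*) [TopologicalSpace M] [ChartedSpace E M] : Prop where
  smooth_chart_change : ∀ e ∈ atlas E M, ∀ e' ∈ atlas E M,
    LCSmoothOn (e' ∘ e.symm) (e.target ∩ e.symm ⁻¹' e'.source)

section Maps

variable (E : Type*) [AddCommGroup E] [Module ℝ E] [TopologicalSpace E]
  (E' : Type*) [AddCommGroup E'] [Module ℝ E'] [TopologicalSpace E']
  {M : Type*} [TopologicalSpace M] [ChartedSpace E M]
  {N : Type*} [TopologicalSpace N] [ChartedSpace E' N]

/-- The map `f : M → N` (only its values on the open set `U ⊆ M` matter) is smooth on `U`: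
it is continuous there and smooth in all charts. -/
def MSmoothOn (f : M → N) (U : Set M) : Prop :=
  ContinuousOn f U ∧ ∀ e ∈ atlas E M, ∀ e' ∈ atlas E' N,
    LCSmoothOn (e' ∘ f ∘ e.symm) (e.target ∩ e.symm ⁻¹' (U ∩ f ⁻¹' e'.source))

/-- Smooth maps between manifolds. -/
def MSmooth (f : M → N) : Prop := MSmoothOn E E' f univ

/-- The tangent space `T_m(M)`. A tangent vector at `m` is represented by its coordinate vector in
the preferred chart `chartAt E m` around `m` (as in Mathlib's `TangentSpace`). -/
abbrev LCTangentSpace {M : Type*} (_m : M) : Type _ := E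

/-- The tangent map `T_m(f) : T_m(M) → T_{f(m)}(N)` of a smooth map `f`. -/
def MTangentMap (f : M → N) (m : M) (v : LCTangentSpace E m) : LCTangentSpace E' (f m) :=
  dirDeriv (chartAt E' (f m) ∘ f ∘ (chartAt E m).symm) (chartAt E m m) v

/-- The differential `dF(m) : T_m(M) → ℝ` of a smooth function `F : M → ℝ`. -/
def MDifferential (F : M → ℝ) (m : M) (v : LCTangentSpace E m) : ℝ :=
  dirDeriv (F ∘ (chartAt E m).symm) (chartAt E m m) v

/-- The vector field `X` on `M` is smooth: in every chart `e` of the atlas the coordinate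
representation `e.target → E`, `x ↦ T_p(e) (X p)`, `p = e⁻¹(x)`, is smooth. -/
def IsSmoothVectorField (X : ∀ m : M, LCTangentSpace E m) : Prop :=
  ∀ e ∈ atlas E M,
    LCSmoothOn (fun x : E =>
      dirDeriv (e ∘ (chartAt E (e.symm x)).symm) (chartAt E (e.symm x) (e.symm x)) (X (e.symm x)))
      e.target

/-- A submersion: a smooth surjective map `q : M → N` with smooth local sections, i.e. every point
of `N` has an open neighbourhood on which a smooth section of `q` is defined. -/
structure IsLCSubmersion (q : M → N) : Prop where
  smooth : MSmooth E E' q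
  surjective : Function.Surjective q
  exists_section : ∀ n : N, ∃ (U : Set N) (s : N → M), IsOpen U ∧ n ∈ U ∧
    MSmoothOn E' E s U ∧ ∀ y ∈ U, q (s y) = y

end Maps

/-! ### Weak Poisson structures -/

/-- A weak Poisson structure on the manifold `M` modelled on `E`: a unital subalgebra `A` of
`C^∞(M, ℝ)` with a Poisson bracket, whose differentials separate tangent vectors, and all of whose
elements have smooth Hamiltonian vector fields. -/
structure WeakPoissonStructure (E : Type*) [AddCommGroup E] [Module ℝ E] [TopologicalSpace E]
    (M : Type*) [TopologicalSpace M] [ChartedSpace E M] where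
  /-- the unital algebra of admissible functions -/
  A : Subalgebra ℝ (M → ℝ)
  smooth : ∀ F ∈ A, MSmooth E ℝ F
  /-- the (bilinear) Poisson bracket -/
  bracket : A →ₗ[ℝ] A →ₗ[ℝ] A
  skew : ∀ F G : A, bracket F G = -bracket G F
  jacobi : ∀ F G H : A,
    bracket F (bracket G H) = bracket (bracket F G) H + bracket G (bracket F H)
  leibniz : ∀ F G H : A, bracket F (G * H) = bracket F G * H + G * bracket F H
  separating : ∀ (m : M) (v : LCTangentSpace E m),
    (∀ F ∈ A, MDifferential E F m v = 0) → v = 0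
  hamiltonian : ∀ H : A, ∃ X : ∀ m : M, LCTangentSpace E m, IsSmoothVectorField E X ∧
    ∀ (F : A) (m : M), MDifferential E (F : M → ℝ) m (X m) = (bracket F H : M → ℝ) m

section Poisson

variable {E : Type*} [AddCommGroup E] [Module ℝ E] [TopologicalSpace E]
  {E' : Type*} [AddCommGroup E'] [Module ℝ E'] [TopologicalSpace E']
  {M : Type*} [TopologicalSpace M] [ChartedSpace E M]
  {N : Type*} [TopologicalSpace N] [ChartedSpace E' N]

/-- A smooth map `φ : M → N` of weak Poisson manifolds is a Poisson map if `φ^* A_N ⊆ A_M` and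
`φ^* {f, g} = {φ^* f, φ^* g}` for all `f, g ∈ A_N`. -/
def IsPoissonMap (P : WeakPoissonStructure E M) (Q : WeakPoissonStructure E' N)
    (φ : M → N) : Prop :=
  MSmooth E E' φ ∧ ∃ h : ∀ f ∈ Q.A, f ∘ φ ∈ P.A, ∀ f g : Q.A,
    (Q.bracket f g : N → ℝ) ∘ φ =
      (P.bracket ⟨(f : N → ℝ) ∘ φ, h f f.2⟩ ⟨(g : N → ℝ) ∘ φ, h g g.2⟩ : M → ℝ)

/-- The unital subalgebra `B` of functions on `M` is a Poisson subalgebra of `(A_M, {·,·})`: it is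
contained in `A_M` and closed under the Poisson bracket. -/
def IsPoissonSubalgebra (P : WeakPoissonStructure E M) (B : Subalgebra ℝ (M → ℝ)) : Prop :=
  B ≤ P.A ∧ ∀ F G : P.A, (F : M → ℝ) ∈ B → (G : M → ℝ) ∈ B → (P.bracket F G : M → ℝ) ∈ B

end Poisson

end

/-!
The algebra of a quotient Poisson structure is forced to be `(q^*)⁻¹(B)`, and its bracket to be the
one that `q^*` carries to the bracket of `B`; since `q` is surjective, `q^*` is injective and skew
symmetry, the Jacobi identity and the Leibniz rule are inherited from `M`. By the chain rule
`d(f ∘ q)(m) v = df(q m)(T_m(q) v)` (`MDifferential_comp`), so the differentials of `B` always vanish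
on `ker T_m(q)`, and the reverse inclusion says that the differentials of `(q^*)⁻¹(B)` separate the
vectors in the image of `T_m(q)`.

* If a quotient structure exists, its differentials separate tangent vectors of `N` by definition
  (`MTangentMap_eq_zero_iff`).
* Conversely, every `n : N` has a preimage `m`, the value of a smooth local section, at which
  `T_m(q)` is surjective (`IsLCSubmersion.exists_MTangentMap_surjective`), so the kernel condition
  makes the differentials of `(q^*)⁻¹(B)` separating on `N`. A Hamiltonian vector field of `H` is the
  image under `T(q)` of one of `q^* H`: it depends only on `q m`, since differentials separate, and
  it is smooth because it can be computed along smooth local sections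
  (`IsSmoothVectorField.of_related`).

The calculus behind this is the chain rule for Michal-Bastiani `C^k`-maps, together with the
additivity of `df(x)` and the locality of smoothness. The chain rule and additivity both follow from
the convergence of difference quotients with moving base point and direction
(`tendsto_slope_of_continuousOn`), a consequence of the mean value theorem in locally convex spaces
(`slope_mem_of_dirDeriv_mem`).
-/

/-! ### The mean value theorem and the chain rule -/

section Calculus

variable {E : Type*} [AddCommGroup E] [Module ℝ E]
  {F : Type*} [AddCommGroup F] [Module ℝ F] [TopologicalSpace F]
  {G : Type*} [AddCommGroup G] [Module ℝ G] [TopologicalSpace G]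

theorem HasDirDerivAt.dirDeriv_eq [T2Space F] {f : E → F} {w : F} {x h : E}
    (hf : HasDirDerivAt f w x h) : dirDeriv f x h = w :=
  letI : Nonempty F := ⟨0⟩
  Tendsto.limUnder_eq hf

theorem dirDeriv_zero [T2Space F] (f : E → F) (x : E) : dirDeriv f x 0 = 0 := by
  refine HasDirDerivAt.dirDeriv_eq ?_
  simp only [HasDirDerivAt, smul_zero, add_zero, sub_self]
  exact tendsto_const_nhds

theorem HasDirDerivAt.hasDerivAt_comp_line {f : E → F} {w : F} {a b : E} {r : ℝ}
    (hf : HasDirDerivAt f w (a + r • b) b) (l : F →L[ℝ] ℝ) :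
    HasDerivAt (fun r : ℝ => l (f (a + r • b))) (l w) r := by
  rw [hasDerivAt_iff_tendsto_slope_zero]
  refine ((l.continuous.tendsto w).comp hf).congr fun t => ?_
  simp [add_smul, add_assoc]

/-- Mean value theorem: a difference quotient lies in every closed convex set containing the
directional derivatives along the segment. By Hahn-Banach it is enough to test against continuous
linear functionals, where it is the classical mean value theorem. -/
theorem slope_mem_of_dirDeriv_mem [IsTopologicalAddGroup F] [ContinuousSMul ℝ F]
    [LocallyConvexSpace ℝ F] {f : E → F} {f' : E → F} {C : Set F} (hC : Convex ℝ C)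
    (hC' : IsClosed C) {a b : E} {t : ℝ} (ht : t ≠ 0)
    (hf : ∀ s ∈ Icc (0 : ℝ) 1, HasDirDerivAt f (f' (a + (s * t) • b)) (a + (s * t) • b) b)
    (hf' : ∀ s ∈ Icc (0 : ℝ) 1, f' (a + (s * t) • b) ∈ C) :
    t⁻¹ • (f (a + t • b) - f a) ∈ C := by
  by_contra hz
  obtain ⟨l, u, hu, hlu⟩ := geometric_hahn_banach_point_closed hC hC' hz
  have hd : ∀ s ∈ Icc (0 : ℝ) 1, HasDerivAt (fun s : ℝ => l (f (a + (s * t) • b)))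
      (l (f' (a + (s * t) • b)) * t) s := fun s hs => by
    have h2 : HasDerivAt (fun s : ℝ => s * t) t s := by
      simpa using (hasDerivAt_id s).mul_const t
    exact ((hf s hs).hasDerivAt_comp_line l).comp s h2
  obtain ⟨s, hs, hs'⟩ := exists_hasDerivAt_eq_slope (fun s : ℝ => l (f (a + (s * t) • b)))
    (fun s => l (f' (a + (s * t) • b)) * t) zero_lt_one
    (fun s hs => (hd s hs).continuousAt.continuousWithinAt)
    (fun s hs => hd s (Ioo_subset_Icc_self hs))
  have h3 := hlu _ (hf' s (Ioo_subset_Icc_self hs))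
  simp only [one_mul, zero_mul, zero_smul, add_zero, sub_zero, div_one] at hs'
  rw [map_smul, map_sub, ← hs', smul_eq_mul, mul_comm, mul_assoc, mul_inv_cancel₀ ht,
    mul_one] at hu
  exact lt_asymm hu h3

variable [TopologicalSpace E]

theorem eventually_add_smul [IsTopologicalAddGroup E] [ContinuousSMul ℝ E] {p : E → Prop} {x : E}
    (hp : ∀ᶠ y in 𝓝 x, p y) (h : E) : ∀ᶠ t : ℝ in 𝓝[≠] 0, p (x + t • h) := by
  have hc : Tendsto (fun t : ℝ => x + t • h) (𝓝 0) (𝓝 x) := by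
    have : Continuous (fun t : ℝ => x + t • h) := by fun_prop
    simpa using this.tendsto 0
  exact (hc.mono_left nhdsWithin_le_nhds).eventually hp

theorem HasDirDerivAt.congr_of_eventuallyEq [IsTopologicalAddGroup E] [ContinuousSMul ℝ E]
    {f g : E → F} {w : F} {x h : E}
    (hf : HasDirDerivAt f w x h) (hfg : f =ᶠ[𝓝 x] g) : HasDirDerivAt g w x h := by
  refine Tendsto.congr' ?_ hf
  filter_upwards [eventually_add_smul hfg h] with t ht
  rw [ht, hfg.eq_of_nhds]

theorem dirDeriv_congr [IsTopologicalAddGroup E] [ContinuousSMul ℝ E]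
    {f g : E → F} {x : E} (hfg : f =ᶠ[𝓝 x] g) (h : E) : dirDeriv f x h = dirDeriv g x h := by
  unfold dirDeriv limUnder
  congr 1
  refine map_congr ?_
  filter_upwards [eventually_add_smul hfg h] with t ht
  rw [ht, hfg.eq_of_nhds]

theorem dirDeriv_id [T2Space E] (x h : E) : dirDeriv (id : E → E) x h = h := by
  refine HasDirDerivAt.dirDeriv_eq (tendsto_const_nhds.congr' ?_)
  filter_upwards [self_mem_nhdsWithin] with t (ht : t ≠ 0)
  simp [smul_smul, inv_mul_cancel₀ ht]

/-- For a `C^1`-map `f`, difference quotients with moving base point `Y t → y` and moving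
direction `K t → k` converge to the directional derivative at `y` in the direction `k`. -/
theorem tendsto_slope_of_continuousOn [IsTopologicalAddGroup E] [ContinuousSMul ℝ E]
    [IsTopologicalAddGroup F] [ContinuousSMul ℝ F] [LocallyConvexSpace ℝ F]
    {f : E → F} {df : E × E → F} {V : Set E} (hV : IsOpen V)
    (hf : ∀ x ∈ V, ∀ h, HasDirDerivAt f (df (x, h)) x h) (hdf : ContinuousOn df (V ×ˢ univ))
    {Y K : ℝ → E} {y k : E} (hy : y ∈ V) (hY : Tendsto Y (𝓝[≠] 0) (𝓝 y))
    (hK : Tendsto K (𝓝[≠] 0) (𝓝 k)) :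
    Tendsto (fun t : ℝ => t⁻¹ • (f (Y t + t • K t) - f (Y t))) (𝓝[≠] 0) (𝓝 (df (y, k))) := by
  intro W hW
  obtain ⟨W', hW', hW'c, hW'W⟩ := exists_mem_nhds_isClosed_subset hW
  obtain ⟨C₀, ⟨hC₀, hC₀c⟩, hC₀W⟩ :=
    (LocallyConvexSpace.convex_basis (𝕜 := ℝ) (df (y, k))).mem_iff.1 hW'
  -- The closure of a convex neighbourhood inside a closed neighbourhood is closed and convex.
  have hC : closure C₀ ∈ 𝓝 (df (y, k)) := mem_of_superset hC₀ subset_closure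
  have hCW : closure C₀ ⊆ W := (hW'c.closure_subset_iff.2 hC₀W).trans hW'W
  have hVo : V ×ˢ (univ : Set E) ∈ 𝓝 (y, k) := (hV.prod isOpen_univ).mem_nhds ⟨hy, mem_univ _⟩
  have hO : ∀ᶠ p : E × E in 𝓝 (y, k), p.1 ∈ V ∧ df p ∈ closure C₀ := by
    filter_upwards [hVo, (hdf.continuousAt hVo).eventually hC] with p hp hp'
    exact ⟨hp.1, hp'⟩
  -- The segments from `Y t` to `Y t + t • K t` are controlled uniformly: `(a, b, r) ↦ a + r • b` is
  -- continuous at `(y, k, 0)`, and `r = s * t` satisfies `|r| ≤ |t|` for all `s ∈ [0, 1]`.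
  have hc : Tendsto (fun z : (E × E) × ℝ => (z.1.1 + z.2 • z.1.2, z.1.2)) (𝓝 ((y, k), (0 : ℝ)))
      (𝓝 (y, k)) := by
    have : Continuous (fun z : (E × E) × ℝ => (z.1.1 + z.2 • z.1.2, z.1.2)) := by fun_prop
    simpa using this.tendsto ((y, k), 0)
  have hev := hc.eventually hO
  rw [nhds_prod_eq, eventually_prod_iff] at hev
  obtain ⟨pa, hpa, pb, hpb, hev⟩ := hev
  obtain ⟨ε, hε, hball⟩ := Metric.eventually_nhds_iff.1 hpb
  have hsmall : ∀ᶠ t : ℝ in 𝓝[≠] 0, dist t 0 < ε :=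
    nhdsWithin_le_nhds (Metric.ball_mem_nhds 0 hε)
  rw [mem_map]
  filter_upwards [(hY.prodMk_nhds hK).eventually hpa, hsmall, self_mem_nhdsWithin]
    with t hta htε (ht0 : t ≠ 0)
  have key : ∀ s ∈ Icc (0 : ℝ) 1, Y t + (s * t) • K t ∈ V ∧
      df (Y t + (s * t) • K t, K t) ∈ closure C₀ := fun s hs => by
    refine hev hta (hball ?_)
    rw [dist_zero_right, norm_mul, Real.norm_of_nonneg hs.1]
    rw [dist_zero_right] at htε
    exact (mul_le_of_le_one_left (norm_nonneg _) hs.2).trans_lt htε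
  exact hCW (slope_mem_of_dirDeriv_mem (f' := fun x => df (x, K t)) hC₀c.closure isClosed_closure
    ht0 (fun s hs => hf _ (key s hs).1 _) (fun s hs => (key s hs).2))

/-- Chain rule. Only the outer map has to be `C^1`: the inner one needs no more than a directional
derivative. -/
theorem HasDirDerivAt.comp [IsTopologicalAddGroup E] [ContinuousSMul ℝ E]
    [IsTopologicalAddGroup F] [ContinuousSMul ℝ F]
    [IsTopologicalAddGroup G] [ContinuousSMul ℝ G] [LocallyConvexSpace ℝ G]
    {f : F → G} {df : F × F → G} {V : Set F} (hV : IsOpen V)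
    (hf : ∀ x ∈ V, ∀ h, HasDirDerivAt f (df (x, h)) x h) (hdf : ContinuousOn df (V ×ˢ univ))
    {g : E → F} {w : F} {x h : E} (hx : g x ∈ V) (hg : HasDirDerivAt g w x h) :
    HasDirDerivAt (f ∘ g) (df (g x, w)) x h := by
  refine (tendsto_slope_of_continuousOn hV hf hdf hx tendsto_const_nhds hg).congr' ?_
  filter_upwards [self_mem_nhdsWithin] with t (ht : t ≠ 0)
  simp [smul_smul, mul_inv_cancel₀ ht]

/-! ### Calculus of `C^k`-maps -/

theorem LCContDiffOn.continuousOn {f : E → F} {U : Set E} {k : ℕ} (hf : LCContDiffOn k f U) :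
    ContinuousOn f U := by
  cases k with
  | zero => exact hf
  | succ k => exact hf.1

theorem LCContDiffOn.of_succ {k : ℕ} :
    ∀ {E : Type*} [AddCommGroup E] [Module ℝ E] [TopologicalSpace E] {f : E → F} {U : Set E},
      LCContDiffOn (k + 1) f U → LCContDiffOn k f U := by
  induction k with
  | zero => exact fun hf => hf.1
  | succ k ih => exact fun ⟨hf, df, hd, hdf⟩ => ⟨hf, df, hd, ih hdf⟩

theorem LCContDiffOn.mono {k : ℕ} :
    ∀ {E : Type*} [AddCommGroup E] [Module ℝ E] [TopologicalSpace E] {f : E → F} {U V : Set E},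
      LCContDiffOn k f U → V ⊆ U → LCContDiffOn k f V := by
  induction k with
  | zero => exact fun hf hV => ContinuousOn.mono hf hV
  | succ k ih =>
    exact fun ⟨hf, df, hd, hdf⟩ hV => ⟨hf.mono hV, df, fun x hx => hd x (hV hx),
      ih hdf (prod_mono hV subset_rfl)⟩

theorem LCContDiffOn.congr {k : ℕ} :
    ∀ {E : Type*} [AddCommGroup E] [Module ℝ E] [TopologicalSpace E] [IsTopologicalAddGroup E]
      [ContinuousSMul ℝ E] {f g : E → F} {U : Set E} (_ : IsOpen U),
      LCContDiffOn k f U → EqOn g f U → LCContDiffOn k g U := by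
  cases k with
  | zero => exact fun _ hf hg => ContinuousOn.congr hf hg
  | succ k =>
    exact fun hU ⟨hf, df, hd, hdf⟩ hg => ⟨hf.congr hg, df, fun x hx h =>
      (hd x hx h).congr_of_eventuallyEq ((hg.eventuallyEq_of_mem (hU.mem_nhds hx)).symm), hdf⟩

/-- Since limits are unique, the derivative in the definition of a `C^(k+1)`-map may be taken to
be `dirDeriv f`. -/
theorem lcContDiffOn_succ_iff [IsTopologicalAddGroup E] [ContinuousSMul ℝ E] [T2Space F]
    {f : E → F} {U : Set E} (hU : IsOpen U) {k : ℕ} :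
    LCContDiffOn (k + 1) f U ↔ ContinuousOn f U ∧
      (∀ x ∈ U, ∀ h, HasDirDerivAt f (dirDeriv f x h) x h) ∧
      LCContDiffOn k (fun p : E × E => dirDeriv f p.1 p.2) (U ×ˢ univ) := by
  constructor
  · rintro ⟨hf, df, hd, hdf⟩
    have heq : ∀ x ∈ U, ∀ h, dirDeriv f x h = df (x, h) := fun x hx h => (hd x hx h).dirDeriv_eq
    refine ⟨hf, fun x hx h => ?_, hdf.congr (hU.prod isOpen_univ) fun p hp => heq _ hp.1 _⟩
    rw [heq x hx]
    exact hd x hx h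
  · rintro ⟨hf, hd, hdf⟩
    exact ⟨hf, _, hd, hdf⟩

theorem LCContDiffOn.of_locally [T2Space F] {k : ℕ} :
    ∀ {E : Type*} [AddCommGroup E] [Module ℝ E] [TopologicalSpace E] [IsTopologicalAddGroup E]
      [ContinuousSMul ℝ E] {f : E → F} {U : Set E} (_ : IsOpen U),
      (∀ x ∈ U, ∃ V, IsOpen V ∧ x ∈ V ∧ V ⊆ U ∧ LCContDiffOn k f V) → LCContDiffOn k f U := by
  induction k with
  | zero =>
    intro E _ _ _ _ _ f U hU h x hx
    obtain ⟨V, hV, hxV, -, hf⟩ := h x hx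
    exact (ContinuousOn.continuousAt hf (hV.mem_nhds hxV)).continuousWithinAt
  | succ k ih =>
    intro E _ _ _ _ _ f U hU h
    rw [lcContDiffOn_succ_iff hU]
    refine ⟨fun x hx => ?_, fun x hx => ?_, ih (hU.prod isOpen_univ) fun p hp => ?_⟩
    · obtain ⟨V, hV, hxV, -, hf⟩ := h x hx
      exact (hf.1.continuousAt (hV.mem_nhds hxV)).continuousWithinAt
    · obtain ⟨V, hV, hxV, -, hf⟩ := h x hx
      exact ((lcContDiffOn_succ_iff hV).1 hf).2.1 x hxV
    · obtain ⟨V, hV, hxV, hVU, hf⟩ := h p.1 hp.1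
      exact ⟨V ×ˢ univ, hV.prod isOpen_univ, ⟨hxV, mem_univ _⟩, prod_mono hVU subset_rfl,
        ((lcContDiffOn_succ_iff hV).1 hf).2.2⟩

theorem LCContDiffOn.comp_continuousLinearMap {k : ℕ} :
    ∀ {D : Type*} [AddCommGroup D] [Module ℝ D] [TopologicalSpace D]
      {E : Type*} [AddCommGroup E] [Module ℝ E] [TopologicalSpace E] {f : E → F} {U : Set E}
      (_ : LCContDiffOn k f U) (L : D →L[ℝ] E), LCContDiffOn k (f ∘ L) (L ⁻¹' U) := by
  induction k with
  | zero => exact fun hf L => ContinuousOn.comp hf L.continuous.continuousOn fun _ hx => hx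
  | succ k ih =>
    intro D _ _ _ E _ _ _ f U ⟨hf, df, hd, hdf⟩ L
    refine ⟨hf.comp L.continuous.continuousOn fun _ hx => hx, df ∘ L.prodMap L, fun x hx h => ?_,
      (ih hdf (L.prodMap L)).mono fun p hp => ⟨hp.1, mem_univ _⟩⟩
    simpa [HasDirDerivAt] using hd (L x) hx (L h)

theorem LCContDiffOn.prodMk {k : ℕ} :
    ∀ {E : Type*} [AddCommGroup E] [Module ℝ E] [TopologicalSpace E] {f : E → F} {g : E → G}
      {U : Set E}, LCContDiffOn k f U → LCContDiffOn k g U →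
      LCContDiffOn k (fun x => (f x, g x)) U := by
  induction k with
  | zero => exact fun hf hg => ContinuousOn.prodMk hf hg
  | succ k ih =>
    exact fun ⟨hf, df, hd, hdf⟩ ⟨hg, dg, hd', hdg⟩ => ⟨hf.prodMk hg, fun p => (df p, dg p),
      fun x hx h => (hd x hx h).prodMk_nhds (hd' x hx h), ih hdf hdg⟩

theorem LCContDiffOn.comp [IsTopologicalAddGroup G] [ContinuousSMul ℝ G] [LocallyConvexSpace ℝ G]
    {k : ℕ} :
    ∀ {E : Type*} [AddCommGroup E] [Module ℝ E] [TopologicalSpace E] [IsTopologicalAddGroup E]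
      [ContinuousSMul ℝ E]
      {F : Type*} [AddCommGroup F] [Module ℝ F] [TopologicalSpace F] [IsTopologicalAddGroup F]
      [ContinuousSMul ℝ F] {f : F → G} {g : E → F} {U : Set E} {V : Set F} (_ : IsOpen V),
      LCContDiffOn k f V → LCContDiffOn k g U → MapsTo g U V → LCContDiffOn k (f ∘ g) U := by
  induction k with
  | zero => exact fun _ hf hg hm => ContinuousOn.comp hf hg hm
  | succ k ih =>
    intro E _ _ _ _ _ F _ _ _ _ _ f g U V hV ⟨hf, df, hd, hdf⟩ hg hm
    have hg' := hg.of_succ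
    obtain ⟨hg, dg, hd', hdg⟩ := hg
    refine ⟨hf.comp hg hm, df ∘ fun p : E × E => (g p.1, dg p), fun x hx h =>
      (hd' x hx h).comp hV hd hdf.continuousOn (hm hx),
      ih (hV.prod isOpen_univ) hdf (LCContDiffOn.prodMk
        ((hg'.comp_continuousLinearMap (ContinuousLinearMap.fst ℝ E E)).mono fun p hp => hp.1) hdg)
        fun p hp => ⟨hm hp.1, mem_univ _⟩⟩

theorem LCSmoothOn.hasDirDerivAt [IsTopologicalAddGroup E] [ContinuousSMul ℝ E] [T2Space F]
    {f : E → F} {U : Set E} (hU : IsOpen U) (hf : LCSmoothOn f U) {x : E} (hx : x ∈ U) (h : E) :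
    HasDirDerivAt f (dirDeriv f x h) x h :=
  ((lcContDiffOn_succ_iff hU).1 (hf 1)).2.1 x hx h

theorem LCSmoothOn.dirDeriv [IsTopologicalAddGroup E] [ContinuousSMul ℝ E] [T2Space F]
    {f : E → F} {U : Set E} (hU : IsOpen U) (hf : LCSmoothOn f U) :
    LCSmoothOn (fun p : E × E => dirDeriv f p.1 p.2) (U ×ˢ univ) :=
  fun k => ((lcContDiffOn_succ_iff hU).1 (hf (k + 1))).2.2

theorem LCSmoothOn.dirDeriv_comp [IsTopologicalAddGroup E] [ContinuousSMul ℝ E]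
    [IsTopologicalAddGroup F] [ContinuousSMul ℝ F] [T2Space F]
    [IsTopologicalAddGroup G] [ContinuousSMul ℝ G] [LocallyConvexSpace ℝ G] [T2Space G]
    {f : F → G} {g : E → F} {U : Set E} {V : Set F} (hU : IsOpen U) (hV : IsOpen V)
    (hf : LCSmoothOn f V) (hg : LCSmoothOn g U) {x : E} (hx : x ∈ U) (hgx : g x ∈ V) (h : E) :
    _root_.dirDeriv (f ∘ g) x h = _root_.dirDeriv f (g x) (_root_.dirDeriv g x h) :=
  ((hg.hasDirDerivAt hU hx h).comp hV (fun _ hy k => hf.hasDirDerivAt hV hy k)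
    (hf.dirDeriv hV 0) hgx).dirDeriv_eq

/-- Additivity of `df(x)`: the increment from `x` to `x + t(h + k)` is split at `x + t h`, and the
second part is a difference quotient with moving base point. -/
theorem LCSmoothOn.dirDeriv_add [IsTopologicalAddGroup E] [ContinuousSMul ℝ E]
    [IsTopologicalAddGroup F] [ContinuousSMul ℝ F] [LocallyConvexSpace ℝ F] [T2Space F]
    {f : E → F} {U : Set E} (hU : IsOpen U) (hf : LCSmoothOn f U) {x : E} (hx : x ∈ U) (h k : E) :
    _root_.dirDeriv f x (h + k) = _root_.dirDeriv f x h + _root_.dirDeriv f x k := by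
  have hY : Tendsto (fun t : ℝ => x + t • h) (𝓝[≠] 0) (𝓝 x) :=
    fun s hs => eventually_add_smul (p := (· ∈ s)) hs h
  have h₁ := tendsto_slope_of_continuousOn hU (fun _ hy k => hf.hasDirDerivAt hU hy k)
    (hf.dirDeriv hU 0) hx hY (tendsto_const_nhds (x := k))
  refine HasDirDerivAt.dirDeriv_eq (((hf.hasDirDerivAt hU hx h).add h₁).congr fun t => ?_)
  rw [← smul_add, smul_add t h k, ← add_assoc, sub_add_sub_cancel']

end Calculus

/-! ### Tangent maps in charts -/

section Manifold

variable {E : Type*} [AddCommGroup E] [Module ℝ E] [TopologicalSpace E]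
  {E' : Type*} [AddCommGroup E'] [Module ℝ E'] [TopologicalSpace E']
  {E'' : Type*} [AddCommGroup E''] [Module ℝ E''] [TopologicalSpace E'']
  {M : Type*} [TopologicalSpace M]

/-- The tangent map of a map which is the identity near `m` is the identity. -/
theorem dirDeriv_chart_id [IsTopologicalAddGroup E] [ContinuousSMul ℝ E] [T2Space E]
    (c : OpenPartialHomeomorph M E) {m : M} (hm : m ∈ c.source) {f : M → M} {U : Set M}
    (hU : IsOpen U) (hmU : m ∈ U) (hf : ∀ x ∈ U, f x = x) (v : E) :
    dirDeriv (c ∘ f ∘ c.symm) (c m) v = v := by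
  have hmem : c m ∈ c.target ∩ c.symm ⁻¹' U :=
    ⟨c.map_source hm, by simpa [c.left_inv hm] using hmU⟩
  refine (dirDeriv_congr ?_ _).trans (dirDeriv_id (c m) v)
  filter_upwards [(c.isOpen_inter_preimage_symm hU).mem_nhds hmem] with x hx
  simp [hf _ hx.2, c.right_inv hx.1]

variable [ChartedSpace E M]
  {N : Type*} [TopologicalSpace N] [ChartedSpace E' N]
  {K : Type*} [TopologicalSpace K] [ChartedSpace E'' K]

theorem MDifferential_zero (f : M → ℝ) (m : M) : MDifferential E f m (0 : E) = 0 :=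
  dirDeriv_zero _ _

theorem MSmoothOn.isOpen_chart_domain {f : M → N} {U : Set M} (hU : IsOpen U)
    (hf : MSmoothOn E E' f U) (c : OpenPartialHomeomorph M E) (e : OpenPartialHomeomorph N E') :
    IsOpen (c.target ∩ c.symm ⁻¹' (U ∩ f ⁻¹' e.source)) :=
  c.isOpen_inter_preimage_symm (hf.1.isOpen_inter_preimage hU e.open_source)

theorem mSmoothOn_id [LCManifold E M] : MSmoothOn E E (id : M → M) univ :=
  ⟨continuousOn_id, fun e he e' he' => by
    simpa using LCManifold.smooth_chart_change e he e' he'⟩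

/-- The chain rule for tangent maps, read in arbitrary charts of the atlases. -/
theorem dirDeriv_chart_comp
    [IsTopologicalAddGroup E] [ContinuousSMul ℝ E]
    [IsTopologicalAddGroup E'] [ContinuousSMul ℝ E'] [T2Space E']
    [IsTopologicalAddGroup E''] [ContinuousSMul ℝ E''] [LocallyConvexSpace ℝ E''] [T2Space E'']
    {f : M → N} {g : N → K} {U : Set M} {V : Set N} (hU : IsOpen U) (hV : IsOpen V)
    (hf : MSmoothOn E E' f U) (hg : MSmoothOn E' E'' g V) {m : M} (hm : m ∈ U) (hfm : f m ∈ V)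
    {c : OpenPartialHomeomorph M E} (hc : c ∈ atlas E M) (hmc : m ∈ c.source)
    {e : OpenPartialHomeomorph N E'} (he : e ∈ atlas E' N) (hme : f m ∈ e.source)
    {d : OpenPartialHomeomorph K E''} (hd : d ∈ atlas E'' K) (hmd : g (f m) ∈ d.source) (v : E) :
    dirDeriv (d ∘ (g ∘ f) ∘ c.symm) (c m) v =
      dirDeriv (d ∘ g ∘ e.symm) (e (f m)) (dirDeriv (e ∘ f ∘ c.symm) (c m) v) := by
  have hmem : c m ∈ c.target ∩ c.symm ⁻¹' (U ∩ f ⁻¹' e.source) :=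
    ⟨c.map_source hmc, by simpa [c.left_inv hmc] using ⟨hm, hme⟩⟩
  have hmem' : (e ∘ f ∘ c.symm) (c m) ∈ e.target ∩ e.symm ⁻¹' (V ∩ g ⁻¹' d.source) := by
    simpa [c.left_inv hmc, e.left_inv hme, hfm, hmd] using e.map_source hme
  have hopen := hf.isOpen_chart_domain hU c e
  have h := LCSmoothOn.dirDeriv_comp hopen (hg.isOpen_chart_domain hV e d)
    (hg.2 e he d hd) (hf.2 c hc e he) hmem hmem' v
  have hval : (e ∘ f ∘ c.symm) (c m) = e (f m) := by simp [c.left_inv hmc]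
  rw [hval] at h
  rw [← h]
  refine dirDeriv_congr ?_ v
  filter_upwards [hopen.mem_nhds hmem] with x hx
  simp [e.left_inv hx.2.2]

variable [IsTopologicalAddGroup E] [ContinuousSMul ℝ E]
  [IsTopologicalAddGroup E'] [ContinuousSMul ℝ E'] [T2Space E']

theorem MDifferential_comp {q : M → N} (hq : MSmooth E E' q) {f : N → ℝ} (hf : MSmooth E' ℝ f)
    (m : M) (v : E) :
    MDifferential E (f ∘ q) m v = MDifferential E' f (q m) (MTangentMap E E' q m v) :=
  dirDeriv_chart_comp (d := OpenPartialHomeomorph.refl ℝ) isOpen_univ isOpen_univ hq hf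
    (mem_univ m) (mem_univ _) (chart_mem_atlas E m) (mem_chart_source E m)
    (chart_mem_atlas E' (q m)) (mem_chart_source E' (q m)) (by simp) (by simp) v

theorem MDifferential_add {f : M → ℝ} (hf : MSmooth E ℝ f) (m : M) (v w : E) :
    MDifferential E f m (v + w : E) = MDifferential E f m v + MDifferential E f m w := by
  have h := hf.2 (chartAt E m) (chart_mem_atlas E m) (OpenPartialHomeomorph.refl ℝ) (by simp)
  refine LCSmoothOn.dirDeriv_add (U := (chartAt E m).target) (chartAt E m).open_target
    (by simpa using h) (mem_chart_target E m) v w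

/-- Over every point lies one, the value of a smooth local section `s` of `q`, at which `T(q)` is
surjective, with right inverse `T(s)`. -/
theorem IsLCSubmersion.exists_MTangentMap_surjective [LocallyConvexSpace ℝ E'] [T2Space E]
    {q : M → N} (hq : IsLCSubmersion E E' q) (n : N) :
    ∃ m : M, q m = n ∧ Function.Surjective (MTangentMap E E' q m : E → E') := by
  obtain ⟨U, s, hU, hn, hs, hsq⟩ := hq.exists_section n
  refine ⟨s n, hsq n hn, fun v => ⟨dirDeriv (chartAt E (s n) ∘ s ∘ (chartAt E' n).symm)
    (chartAt E' n n) v, ?_⟩⟩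
  have hd := chart_mem_atlas E' n
  have hmd := mem_chart_source E' n
  have h := dirDeriv_chart_comp (d := chartAt E' n) hU isOpen_univ hs hq.smooth hn (mem_univ _) hd
    hmd (chart_mem_atlas E (s n)) (mem_chart_source E (s n)) hd (by rwa [hsq n hn]) v
  rw [dirDeriv_chart_id (f := q ∘ s) _ hmd hU hn hsq] at h
  unfold MTangentMap
  rw [hsq n hn]
  exact h.symm

/-- The coordinates of `T_m(q) v` in a chart `e`, computed from those of `v` in a chart `c`. -/
theorem dirDeriv_chart_MTangentMap [LocallyConvexSpace ℝ E] [T2Space E]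
    [LocallyConvexSpace ℝ E'] [LCManifold E M] [LCManifold E' N]
    {q : M → N} (hq : MSmooth E E' q) {m : M} {c : OpenPartialHomeomorph M E}
    (hc : c ∈ atlas E M) (hmc : m ∈ c.source) {e : OpenPartialHomeomorph N E'}
    (he : e ∈ atlas E' N) (hme : q m ∈ e.source) (v : E) :
    dirDeriv (e ∘ (chartAt E' (q m)).symm) (chartAt E' (q m) (q m)) (MTangentMap E E' q m v) =
      dirDeriv (e ∘ q ∘ c.symm) (c m)
        (dirDeriv (c ∘ (chartAt E m).symm) (chartAt E m m) v) := by
  have h₁ := dirDeriv_chart_comp isOpen_univ isOpen_univ hq mSmoothOn_id (mem_univ m)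
    (mem_univ _) (chart_mem_atlas E m) (mem_chart_source E m) (chart_mem_atlas E' (q m))
    (mem_chart_source E' (q m)) he hme v
  have h₂ := dirDeriv_chart_comp isOpen_univ isOpen_univ mSmoothOn_id hq (mem_univ m)
    (mem_univ _) (chart_mem_atlas E m) (mem_chart_source E m) hc hmc he hme v
  exact h₁.symm.trans h₂

/-- A family of tangent vectors of `N` which is the image under `T(q)` of a smooth vector field on
`M` is smooth: near a point, with a smooth section `s` of `q`, its coordinate representation is
`x ↦ dφ(ψ x, Xc (ψ x))`, where `φ`, `ψ` represent `q`, `s`, and `Xc` represents `X`. -/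
theorem IsSmoothVectorField.of_related [LocallyConvexSpace ℝ E'] [LCManifold E M] [LCManifold E' N]
    [LocallyConvexSpace ℝ E] [T2Space E]
    {q : M → N} (hq : IsLCSubmersion E E' q) {X : M → E} (hX : IsSmoothVectorField E X)
    {Z : N → E'} (hZ : ∀ m, Z (q m) = MTangentMap E E' q m (X m)) :
    IsSmoothVectorField E' Z := by
  intro e he k
  refine LCContDiffOn.of_locally e.open_target fun x₀ hx₀ => ?_
  obtain ⟨U, s, hU, hn, hs, hsq⟩ := hq.exists_section (e.symm x₀)
  set c := chartAt E (s (e.symm x₀)) with hc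
  have hca : c ∈ atlas E M := chart_mem_atlas E _
  have hW := hs.isOpen_chart_domain hU e c
  have hV := hq.smooth.isOpen_chart_domain isOpen_univ c e
  have hφ := (hq.smooth.2 c hca e he).dirDeriv hV
  have hψ := hs.2 e he c hca
  refine ⟨_, hW, ⟨hx₀, hn, mem_chart_source E _⟩, inter_subset_left, ?_⟩
  have hψm : MapsTo (c ∘ s ∘ e.symm) (e.target ∩ e.symm ⁻¹' (U ∩ s ⁻¹' c.source)) c.target :=
    fun x hx => c.map_source hx.2.2
  refine LCContDiffOn.congr hW (LCContDiffOn.comp (hV.prod isOpen_univ) (hφ k)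
    (LCContDiffOn.prodMk (hψ k) (LCContDiffOn.comp c.open_target (hX c hca k) (hψ k) hψm))
    fun x hx => ⟨⟨hψm hx, ?_⟩, mem_univ _⟩) fun x hx => ?_
  · have h1 : c.symm (c (s (e.symm x))) = s (e.symm x) := c.left_inv hx.2.2
    simp [h1, hsq _ hx.2.1, e.map_target hx.1]
  · have hq' : q (s (e.symm x)) = e.symm x := hsq _ hx.2.1
    have h1 : c.symm (c (s (e.symm x))) = s (e.symm x) := c.left_inv hx.2.2
    have hr := dirDeriv_chart_MTangentMap hq.smooth hca hx.2.2 he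
      (by rw [hq']; exact e.map_target hx.1) (X (s (e.symm x)))
    rw [← hZ, hq'] at hr
    simpa only [Function.comp_apply, h1] using hr

end Manifold

/-! ### The quotient Poisson structure -/

section Poisson

variable {E : Type*} [AddCommGroup E] [Module ℝ E] [TopologicalSpace E]
  {E' : Type*} [AddCommGroup E'] [Module ℝ E'] [TopologicalSpace E']
  {M N : Type*}

/-- The pullback `q^* : f ↦ f ∘ q` as a homomorphism of algebras of functions. -/
def functionPullback (q : M → N) : (N → ℝ) →ₐ[ℝ] (M → ℝ) where
  toFun f := f ∘ q
  map_one' := rfl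
  map_mul' _ _ := rfl
  map_zero' := rfl
  map_add' _ _ := rfl
  commutes' _ := rfl

theorem functionPullback_injective {q : M → N} (hq : Function.Surjective q) :
    Function.Injective (functionPullback q) := hq.injective_comp_right

/-- The algebra of functions on `N` whose pullback belongs to `B`, i.e. `(q^*)⁻¹(B)`. -/
def quotientAlgebra (q : M → N) (B : Subalgebra ℝ (M → ℝ)) : Subalgebra ℝ (N → ℝ) :=
  B.comap (functionPullback q)

variable [TopologicalSpace M] [ChartedSpace E M]

/-- The pullback as a homomorphism from `(q^*)⁻¹(B)` to the Poisson algebra containing `B`. -/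
def quotientPullback (P : WeakPoissonStructure E M) (q : M → N) (B : Subalgebra ℝ (M → ℝ))
    (hB : B ≤ P.A) : quotientAlgebra q B →ₐ[ℝ] P.A :=
  ((functionPullback q).comp (quotientAlgebra q B).val).codRestrict P.A fun f => hB f.2

theorem quotientPullback_injective (P : WeakPoissonStructure E M) {q : M → N}
    {B : Subalgebra ℝ (M → ℝ)} (hB : B ≤ P.A) (hq : Function.Surjective q) :
    Function.Injective (quotientPullback P q B hB) := fun _ _ h =>
  Subtype.ext (functionPullback_injective hq (congrArg Subtype.val h))

/-- Every bracket of functions in `B` lies in `B`, hence descends along `q`. -/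
theorem exists_quotientPullback_eq_bracket (P : WeakPoissonStructure E M) {q : M → N}
    {B : Subalgebra ℝ (M → ℝ)} (hB : IsPoissonSubalgebra P B)
    (hBq : ∀ F ∈ B, ∃ f : N → ℝ, F = f ∘ q) (f g : quotientAlgebra q B) :
    ∃ k : quotientAlgebra q B, quotientPullback P q B hB.1 k =
      P.bracket (quotientPullback P q B hB.1 f) (quotientPullback P q B hB.1 g) := by
  have h := hB.2 (quotientPullback P q B hB.1 f) (quotientPullback P q B hB.1 g) f.2 g.2
  obtain ⟨k, hk⟩ := hBq _ h
  exact ⟨⟨k, show k ∘ q ∈ B from hk ▸ h⟩, Subtype.ext hk.symm⟩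

/-- The bracket on `(q^*)⁻¹(B)` that `q^*` carries to the bracket on `B`. -/
noncomputable def quotientBracket (P : WeakPoissonStructure E M) {q : M → N}
    (hq : Function.Surjective q) {B : Subalgebra ℝ (M → ℝ)} (hB : IsPoissonSubalgebra P B)
    (hBq : ∀ F ∈ B, ∃ f : N → ℝ, F = f ∘ q) :
    quotientAlgebra q B →ₗ[ℝ] quotientAlgebra q B →ₗ[ℝ] quotientAlgebra q B :=
  have hinj := quotientPullback_injective P hB.1 hq
  have hex := fun f g => (exists_quotientPullback_eq_bracket P hB hBq f g).choose_spec
  LinearMap.mk₂ ℝ (fun f g => (exists_quotientPullback_eq_bracket P hB hBq f g).choose)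
    (fun f f' g => hinj ((hex _ _).trans (by simp only [hex, map_add, LinearMap.add_apply])))
    (fun a f g => hinj ((hex _ _).trans (by simp only [hex, map_smul, LinearMap.smul_apply])))
    (fun f g g' => hinj ((hex _ _).trans (by simp only [hex, map_add])))
    (fun a f g => hinj ((hex _ _).trans (by simp only [hex, map_smul])))

theorem quotientPullback_quotientBracket (P : WeakPoissonStructure E M) {q : M → N}
    (hq : Function.Surjective q) {B : Subalgebra ℝ (M → ℝ)} (hB : IsPoissonSubalgebra P B)
    (hBq : ∀ F ∈ B, ∃ f : N → ℝ, F = f ∘ q) (f g : quotientAlgebra q B) :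
    quotientPullback P q B hB.1 (quotientBracket P hq hB hBq f g) =
      P.bracket (quotientPullback P q B hB.1 f) (quotientPullback P q B hB.1 g) :=
  (exists_quotientPullback_eq_bracket P hB hBq f g).choose_spec

variable [TopologicalSpace N] [ChartedSpace E' N] [IsTopologicalAddGroup E] [ContinuousSMul ℝ E]
  [IsTopologicalAddGroup E'] [ContinuousSMul ℝ E'] [T2Space E']

/-- A Poisson map pulling `A_N` back onto `B` has the common kernel of the differentials of `B` as
the kernel of its tangent map, because the differentials of `A_N` separate tangent vectors. -/
theorem MTangentMap_eq_zero_iff {Q : WeakPoissonStructure E' N}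
    {q : M → N} (hq : MSmooth E E' q) {B : Subalgebra ℝ (M → ℝ)}
    (hQB : (B : Set (M → ℝ)) = (fun f : N → ℝ => f ∘ q) '' (Q.A : Set (N → ℝ)))
    (m : M) (v : E) :
    MTangentMap E E' q m v = 0 ↔ ∀ F ∈ B, MDifferential E F m v = 0 := by
  have hB : ∀ F, F ∈ B ↔ ∃ f ∈ Q.A, f ∘ q = F := fun F => by
    rw [← SetLike.mem_coe, hQB]
    rfl
  constructor
  · intro hv F hF
    obtain ⟨f, hf, rfl⟩ := (hB F).1 hF
    rw [MDifferential_comp hq (Q.smooth f hf), hv]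
    exact MDifferential_zero f _
  · refine fun hv => Q.separating _ _ fun f hf => ?_
    rw [← MDifferential_comp hq (Q.smooth f hf)]
    exact hv _ ((hB _).2 ⟨f, hf, rfl⟩)

variable [LocallyConvexSpace ℝ E] [T2Space E] [LocallyConvexSpace ℝ E']

/-- The weak Poisson structure on `N` with algebra `(q^*)⁻¹(B)`. The Hamiltonian vector field of
`H` is the image under `T(q)` of one of `q^* H`; its value at `q m` does not depend on `m`, because
its derivatives of the functions in `(q^*)⁻¹(B)` are the values at `q m` of brackets. -/
noncomputable def quotientPoissonStructure [LCManifold E M] [LCManifold E' N]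
    (P : WeakPoissonStructure E M) {q : M → N} (hq : IsLCSubmersion E E' q)
    {B : Subalgebra ℝ (M → ℝ)} (hB : IsPoissonSubalgebra P B)
    (hBq : ∀ F ∈ B, ∃ f : N → ℝ, MSmooth E' ℝ f ∧ F = f ∘ q)
    (hker : ∀ (m : M) (v : E), (∀ F ∈ B, MDifferential E F m v = 0) →
      MTangentMap E E' q m v = 0) : WeakPoissonStructure E' N :=
  have hBq' : ∀ F ∈ B, ∃ f : N → ℝ, F = f ∘ q := fun F hF => (hBq F hF).imp fun _ h => h.2
  have hinj := quotientPullback_injective P hB.1 hq.surjective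
  have hbr := quotientPullback_quotientBracket P hq.surjective hB hBq'
  have hsm : ∀ f ∈ quotientAlgebra q B, MSmooth E' ℝ f := fun f hf => by
    obtain ⟨g, hg, hfg⟩ := hBq _ hf
    rwa [show f = g from functionPullback_injective hq.surjective hfg]
  have hsep : ∀ (n : N) (v : E'),
      (∀ f ∈ quotientAlgebra q B, MDifferential E' f n v = 0) → v = 0 := fun n v hv => by
    obtain ⟨m, rfl, hm⟩ := hq.exists_MTangentMap_surjective n
    obtain ⟨w, rfl⟩ := hm v
    refine hker m w fun F hF => ?_
    obtain ⟨f, hf, rfl⟩ := hBq F hF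
    rw [MDifferential_comp hq.smooth hf]
    exact hv f hF
  { A := quotientAlgebra q B
    smooth := hsm
    bracket := quotientBracket P hq.surjective hB hBq'
    skew := fun f g => hinj (by rw [map_neg, hbr, hbr, P.skew])
    jacobi := fun f g h => hinj (by simp only [map_add, hbr]; exact P.jacobi _ _ _)
    leibniz := fun f g h => hinj (by simp only [map_add, map_mul, hbr]; exact P.leibniz _ _ _)
    separating := hsep
    hamiltonian := fun H => by
      obtain ⟨X, hX, hXH⟩ := P.hamiltonian (quotientPullback P q B hB.1 H)
      have hval : ∀ (f : quotientAlgebra q B) (m : M),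
          MDifferential E' (f : N → ℝ) (q m) (MTangentMap E E' q m (X m)) =
            (quotientBracket P hq.surjective hB hBq' f H : N → ℝ) (q m) := fun f m => by
        rw [← MDifferential_comp hq.smooth (hsm f f.2)]
        refine (hXH (quotientPullback P q B hB.1 f) m).trans ?_
        rw [← hbr]
        rfl
      have hZ : ∀ m, (MTangentMap E E' q (Function.surjInv hq.surjective (q m))
          (X (Function.surjInv hq.surjective (q m))) : E') =
            MTangentMap E E' q m (X m) := fun m => by
        have hσ := Function.surjInv_eq hq.surjective (q m)
        generalize Function.surjInv hq.surjective (q m) = m' at hσ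
        -- By `MDifferential_add`, equal values of `df` at two vectors vanish at their difference.
        refine sub_eq_zero.1 (hsep (q m) _ fun f hf => ?_)
        have h₁ := hval ⟨f, hf⟩ m'
        have h₂ := hval ⟨f, hf⟩ m
        rw [hσ] at h₁
        have h₃ := MDifferential_add (hsm f hf) (q m)
          ((MTangentMap E E' q m' (X m') : E') - MTangentMap E E' q m (X m))
          (MTangentMap E E' q m (X m))
        rw [sub_add_cancel] at h₃
        exact left_eq_add.1 ((h₂.trans (h₁.symm.trans h₃)).trans (add_comm _ _))
      refine ⟨fun n => (MTangentMap E E' q (Function.surjInv hq.surjective n)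
        (X (Function.surjInv hq.surjective n)) : E'), hX.of_related hq hZ, fun f n => ?_⟩
      obtain ⟨m, rfl⟩ := hq.surjective n
      rw [← hval, ← hZ] }

end Poisson

theorem proposition2p17
    {E : Type*} [AddCommGroup E] [Module ℝ E] [TopologicalSpace E] [IsTopologicalAddGroup E]
    [ContinuousSMul ℝ E] [LocallyConvexSpace ℝ E] [T2Space E]
    {E' : Type*} [AddCommGroup E'] [Module ℝ E'] [TopologicalSpace E'] [IsTopologicalAddGroup E']
    [ContinuousSMul ℝ E'] [LocallyConvexSpace ℝ E'] [T2Space E']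
    {M : Type*} [TopologicalSpace M] [ChartedSpace E M] [LCManifold E M]
    {N : Type*} [TopologicalSpace N] [ChartedSpace E' N] [LCManifold E' N]
    (P : WeakPoissonStructure E M)
    (q : M → N) (hq : IsLCSubmersion E E' q)
    (B : Subalgebra ℝ (M → ℝ)) (hB : IsPoissonSubalgebra P B)
    (hBq : ∀ F ∈ B, ∃ f : N → ℝ, MSmooth E' ℝ f ∧ F = f ∘ q) :
    (∃ Q : WeakPoissonStructure E' N,
        (B : Set (M → ℝ)) = (fun f : N → ℝ => f ∘ q) '' (Q.A : Set (N → ℝ)) ∧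
        IsPoissonMap P Q q) ↔
      ∀ m : M, {v : LCTangentSpace E m | MTangentMap E E' q m v = 0} =
        {v : LCTangentSpace E m | ∀ F ∈ B, MDifferential E F m v = 0} := by
  constructor
  · rintro ⟨Q, hQB, -⟩ m
    exact Set.ext fun v => MTangentMap_eq_zero_iff hq.smooth hQB m v
  · intro hker
    refine ⟨quotientPoissonStructure P hq hB hBq fun m v hv => (hker m).ge hv, ?_, hq.smooth,
      fun f hf => hB.1 hf, fun f g => ?_⟩
    · ext F
      refine ⟨fun hF => ?_, fun ⟨f, hf, hfF⟩ => hfF ▸ hf⟩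
      obtain ⟨f, -, rfl⟩ := hBq F hF
      exact ⟨f, hF, rfl⟩
    · exact congrArg Subtype.val (quotientPullback_quotientBracket P hq.surjective hB
        (fun F hF => (hBq F hF).imp fun _ h => h.2) f g)
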